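/- Let $R$ be a commutative unital ring in which $x^2=0$ implies $x=0$ (equivalently, $R$ is reduced; this holds in particular if the squaring map $x\mapsto x^2$ on $R$ is injective), let $d\ge 2$, and let $A=R[t_1,\dots,t_d]$, with all tensor products taken over $R$. Then the only double Poisson structure on $A$ (in the sense of Van den Bergh) is the zero one. Explicitly: let $\phi : A\otimes A\to A\otimes A$, $a\otimes b\mapsto \{\!\{a,b\}\!\}$, be an $R$-linear map such that 1. (derivation property) both $\psi=\phi$ and $\psi=\tau\circ\phi\circ\tau^{-1}$, where $\tau(a\otimes b)=b\otimes a$, satisfy $\psi(x\otimes ab)=(a\otimes 1)\,\psi(x\otimes b)+\psi(x\otimes a)\,(1\otimes b)$ for all $a,b,x\in A$; 2. (antisymmetry) $\tau\circ\phi\circ\tau^{-1}=-\phi$; 3. (double Jacobi relation) $\sum_{k=0}^{2}\rho^{k}\circ(\phi\otimes \mathrm{id}_A)\circ(\mathrm{id}_A\otimes\phi)\circ\rho^{-k}=0$ on $A^{\otimes 3}$, where $\rho(a\otimes b\otimes c)=c\otimes a\otimes b$. Then $\phi=0$. -/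

import Mathlib

open scoped TensorProduct

/-!  Double Poisson structures on an associative unital `R`-algebra `A`.
`A ⊗[R] A` carries its usual (factorwise) product, and `A ⊗[R] A ⊗[R] A` is `(A ⊗ A) ⊗ A`. -/

namespace DoublePoisson

section

variable {R A : Type*} [CommRing R] [Ring A] [Algebra R A]

/-- `φ` is a derivation in its last variable, for the outer bimodule structure on `A ⊗ A`:
`φ (x ⊗ ab) = (a ⊗ 1) φ (x ⊗ b) + φ (x ⊗ a) (1 ⊗ b)`. -/
def IsDerivLast (φ : A ⊗[R] A →ₗ[R] A ⊗[R] A) : Prop :=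
  ∀ x a b : A, φ (x ⊗ₜ[R] (a * b)) =
    (a ⊗ₜ[R] (1 : A)) * φ (x ⊗ₜ[R] b) + φ (x ⊗ₜ[R] a) * ((1 : A) ⊗ₜ[R] b)

/-- The action of the transposition `τ` on `Hom (A ⊗ A, A ⊗ A)` by conjugation, `τ ∘ φ ∘ τ⁻¹`. -/
def swapAct (φ : A ⊗[R] A →ₗ[R] A ⊗[R] A) : A ⊗[R] A →ₗ[R] A ⊗[R] A :=
  (TensorProduct.comm R A A).conj φ

/-- A multi-derivation of arity two: every conjugate of `φ` under `ℤ/2` is a derivation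
in the last variable. -/
def IsBiderivation (φ : A ⊗[R] A →ₗ[R] A ⊗[R] A) : Prop :=
  IsDerivLast φ ∧ IsDerivLast (swapAct φ)

/-- A double bracket: an antisymmetric bi-derivation. -/
def IsDoubleBracket (φ : A ⊗[R] A →ₗ[R] A ⊗[R] A) : Prop :=
  IsBiderivation φ ∧ swapAct φ = -φ

variable (R A) in
/-- The generator `a ⊗ b ⊗ c ↦ c ⊗ a ⊗ b` of the cyclic group `ℤ/3` acting on `A ⊗ A ⊗ A`. -/
def rot : (A ⊗[R] A ⊗[R] A) ≃ₗ[R] (A ⊗[R] A ⊗[R] A) :=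
  (TensorProduct.comm R (A ⊗[R] A) A).trans (TensorProduct.assoc R A A A).symm

/-- The composite `(φ ⊗ 1) ∘ (1 ⊗ φ)` on `A ⊗ A ⊗ A`. -/
def jacTerm (φ : A ⊗[R] A →ₗ[R] A ⊗[R] A) : A ⊗[R] A ⊗[R] A →ₗ[R] A ⊗[R] A ⊗[R] A :=
  φ.rTensor A ∘ₗ (TensorProduct.assoc R A A A).symm.toLinearMap ∘ₗ
    φ.lTensor A ∘ₗ (TensorProduct.assoc R A A A).toLinearMap

/-- The double Jacobiator: the sum over `σ ∈ ℤ/3` of the conjugates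
`σ ∘ (φ ⊗ 1) ∘ (1 ⊗ φ) ∘ σ⁻¹`. -/
def jacobiator (φ : A ⊗[R] A →ₗ[R] A ⊗[R] A) :
    A ⊗[R] A ⊗[R] A →ₗ[R] A ⊗[R] A ⊗[R] A :=
  jacTerm φ + (rot R A).conj (jacTerm φ) + (rot R A).conj ((rot R A).conj (jacTerm φ))

/-- A double Poisson structure: a double bracket satisfying the double Jacobi relation. -/
def IsDoublePoisson (φ : A ⊗[R] A →ₗ[R] A ⊗[R] A) : Prop :=
  IsDoubleBracket φ ∧ jacobiator φ = 0

end

end DoublePoisson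

/-! Write `diff a` for `a ⊗ 1 - 1 ⊗ a`. As `A` is commutative, expanding a bracket with `ab = ba`
gives `diff a * φ (x ⊗ b) = diff b * φ (x ⊗ a)`. Two variables have differences forming a regular
sequence, so this and antisymmetry force `φ (a ⊗ b) = diff a * diff b * q` with `q` antisymmetric
(`IsDoubleBracket.exists_eq_diff_mul`). At `t ⊗ t ⊗ t` the Jacobiator is then a product of regular
elements and a quadratic expression in `q` (`jacobiator_tmul_self_eq`). That expression must vanish;
multiplying the first and third factors together turns it into `q ^ 2 = 0`, and reducedness gives `q
= 0`. -/

namespace MvPolynomial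

variable {R S σ : Type*} [CommRing R] [CommRing S] [Algebra R S]

theorem X_dvd_of_X_dvd_X_mul {i j : σ} (hij : i ≠ j) {f : MvPolynomial σ R}
    (h : (X i : MvPolynomial σ R) ∣ X j * f) : (X i : MvPolynomial σ R) ∣ f := by
  rw [X_dvd_iff_modMonomial_eq_zero] at h ⊢
  ext m
  by_cases hm : Finsupp.single i 1 ≤ m
  · rw [coeff_modMonomial_of_le _ hm, coeff_zero]
  · have hm' : ¬ Finsupp.single i 1 ≤ Finsupp.single j 1 + m := by
      rw [Finsupp.single_le_iff] at hm ⊢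
      simpa [Finsupp.single_apply, hij.symm] using hm
    have := congrArg (coeff (Finsupp.single j 1 + m)) h
    rw [coeff_modMonomial_of_not_le _ hm', coeff_X_mul, coeff_zero] at this
    rw [coeff_modMonomial_of_not_le _ hm, this, coeff_zero]

/-- The automorphism of a polynomial ring translating the variables by constants. -/
noncomputable def translate (s : σ → S) : MvPolynomial σ S ≃ₐ[S] MvPolynomial σ S :=
  AlgEquiv.ofAlgHom (aeval fun i => C (s i) + X i) (aeval fun i => X i - C (s i))
    (by ext i; simp [algebraMap_eq]) (by ext i; simp [algebraMap_eq])

/-- The identification of `S ⊗ R[σ]` with `S[σ]` that sends `1 ⊗ X i - s i ⊗ 1` to `X i`. -/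
noncomputable def tensorTranslate (s : σ → S) : S ⊗[R] MvPolynomial σ R ≃ₐ[S] MvPolynomial σ S :=
  (algebraTensorAlgEquiv R S).trans (translate s)

theorem tensorTranslate_apply (s : σ → S) (i : σ) :
    tensorTranslate (R := R) s (s i ⊗ₜ[R] 1 - 1 ⊗ₜ[R] X i) = -X i := by
  simp [tensorTranslate, translate, algebraTensorAlgEquiv_tmul, smul_eq_C_mul, algebraMap_eq]

/-- `S` is arbitrary so that `S = A` covers `A ⊗ A` and `S = A ⊗ A` covers the triple tensor
product. -/
theorem isLeftRegular_tmul_sub_tmul_X (s : σ → S) (i : σ) :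
    IsLeftRegular (s i ⊗ₜ[R] 1 - 1 ⊗ₜ[R] X i : S ⊗[R] MvPolynomial σ R) := by
  intro f g h
  apply (tensorTranslate (R := R) s).injective
  have h' := congrArg (tensorTranslate (R := R) s) h
  simp only [map_mul, tensorTranslate_apply, neg_mul, neg_inj] at h'
  exact isRegular_X.left h'

theorem tmul_sub_tmul_X_dvd (s : σ → S) {i j : σ} (hij : i ≠ j) {f : S ⊗[R] MvPolynomial σ R}
    (h : (s i ⊗ₜ[R] 1 - 1 ⊗ₜ[R] X i) ∣ (s j ⊗ₜ[R] 1 - 1 ⊗ₜ[R] X j) * f) :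
    (s i ⊗ₜ[R] 1 - 1 ⊗ₜ[R] X i) ∣ f := by
  have h' := map_dvd (tensorTranslate (R := R) s) h
  rw [map_mul, tensorTranslate_apply, tensorTranslate_apply, neg_mul, dvd_neg, neg_dvd] at h'
  rw [← map_dvd_iff (tensorTranslate (R := R) s), tensorTranslate_apply, neg_dvd]
  exact X_dvd_of_X_dvd_X_mul hij h'

theorem isReduced_tensorProduct [IsReduced S] : IsReduced (S ⊗[R] MvPolynomial σ R) :=
  isReduced_of_injective (algebraTensorAlgEquiv (σ := σ) R S) (algebraTensorAlgEquiv R S).injective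

end MvPolynomial

namespace DoublePoisson

/-! ### Double brackets on commutative algebras -/

section Commutative

variable {R A : Type*} [CommRing R] [CommRing A] [Algebra R A]

variable (R) in
/-- The universal difference `a ⊗ 1 - 1 ⊗ a`. -/
def diff (a : A) : A ⊗[R] A := a ⊗ₜ[R] 1 - 1 ⊗ₜ[R] a

variable (R A) in
/-- The transposition of tensor factors as an algebra automorphism. -/
def flip : A ⊗[R] A ≃ₐ[R] A ⊗[R] A := Algebra.TensorProduct.comm R A A

@[simp] theorem flip_tmul (a b : A) : flip R A (a ⊗ₜ[R] b) = b ⊗ₜ[R] a := rfl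

theorem flip_diff (a : A) : flip R A (diff R a) = -diff R a := by
  simp [diff]

variable {φ : A ⊗[R] A →ₗ[R] A ⊗[R] A}

theorem IsDerivLast.diff_mul (h : IsDerivLast φ) (x a b : A) :
    diff R a * φ (x ⊗ₜ[R] b) = diff R b * φ (x ⊗ₜ[R] a) := by
  have h1 := h x a b
  rw [mul_comm a b, h x b a] at h1
  simp only [diff]
  linear_combination -h1

theorem flip_apply_of_swapAct_eq_neg (h : swapAct φ = -φ) (a b : A) :
    flip R A (φ (b ⊗ₜ[R] a)) = -φ (a ⊗ₜ[R] b) :=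
  LinearMap.congr_fun h (a ⊗ₜ[R] b)

/-- A double bracket on a commutative algebra is divisible by both universal differences, provided
two of these form a regular sequence. -/
theorem IsDoubleBracket.exists_eq_diff_mul (h : IsDoubleBracket φ) {s t : A}
    (hs : IsLeftRegular (diff R s)) (ht : IsLeftRegular (diff R t))
    (hst : ∀ f, diff R s ∣ diff R t * f → diff R s ∣ f) :
    ∃ q : A ⊗[R] A, flip R A q = -q ∧ ∀ a b, φ (a ⊗ₜ[R] b) = diff R a * diff R b * q := by
  obtain ⟨⟨hd, -⟩, hanti⟩ := h
  have hdvd (x : A) : ∃ D, φ (x ⊗ₜ[R] s) = diff R s * D :=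
    hst _ ⟨φ (x ⊗ₜ[R] t), (hd.diff_mul x s t).symm⟩
  choose D hD using hdvd
  have hφ (a b : A) : φ (a ⊗ₜ[R] b) = diff R b * D a := by
    apply hs
    linear_combination hd.diff_mul a s b + diff R b * hD a
  have hflip (a b : A) : diff R b * D a = diff R a * flip R A (D b) := by
    have := flip_apply_of_swapAct_eq_neg hanti a b
    rw [hφ, hφ, map_mul, flip_diff] at this
    linear_combination this
  -- Comparing `D a` with `D s` through `hflip` makes this single quotient determine every `D a`;
  -- the flip turns it into `-flip q`.
  obtain ⟨q, hq⟩ : diff R s ∣ D s := hst _ ⟨_, hflip s t⟩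
  have key (a b : A) : φ (a ⊗ₜ[R] b) = diff R a * diff R b * -flip R A q := by
    have : D a = diff R a * -flip R A q := by
      apply hs
      have := hflip a s
      rw [hq, map_mul, flip_diff] at this
      linear_combination this
    rw [hφ, this]
    ring
  refine ⟨-flip R A q, ?_, key⟩
  have := flip_apply_of_swapAct_eq_neg hanti s t
  rw [key, key, map_mul, map_mul, flip_diff, flip_diff] at this
  apply ht
  apply hs
  linear_combination this

section Jacobi

variable (R A)

/-- The inclusion of `A ⊗ A` into the first and second factors of `A ⊗ A ⊗ A`. -/
def incl₁₂ : A ⊗[R] A →ₐ[R] A ⊗[R] A ⊗[R] A := Algebra.TensorProduct.includeLeft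

/-- The inclusion of `A ⊗ A` into the first and third factors of `A ⊗ A ⊗ A`. -/
def incl₁₃ : A ⊗[R] A →ₐ[R] A ⊗[R] A ⊗[R] A :=
  Algebra.TensorProduct.map Algebra.TensorProduct.includeLeft (AlgHom.id R A)

/-- The inclusion of `A ⊗ A` into the second and third factors of `A ⊗ A ⊗ A`. -/
def incl₂₃ : A ⊗[R] A →ₐ[R] A ⊗[R] A ⊗[R] A :=
  Algebra.TensorProduct.map Algebra.TensorProduct.includeRight (AlgHom.id R A)

/-- The rotation `a ⊗ b ⊗ c ↦ c ⊗ a ⊗ b` as an algebra automorphism. -/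
def rotAlg : A ⊗[R] A ⊗[R] A ≃ₐ[R] A ⊗[R] A ⊗[R] A :=
  (Algebra.TensorProduct.comm R (A ⊗[R] A) A).trans
    (Algebra.TensorProduct.assoc R R R A A A).symm

/-- The algebra map `a ⊗ b ⊗ c ↦ ac ⊗ b`. -/
noncomputable def mulFirstThird : A ⊗[R] A ⊗[R] A →ₐ[R] A ⊗[R] A :=
  Algebra.TensorProduct.productMap (AlgHom.id R _) Algebra.TensorProduct.includeLeft

variable {R A}

@[simp] theorem incl₁₂_tmul (a b : A) : incl₁₂ R A (a ⊗ₜ[R] b) = a ⊗ₜ[R] b ⊗ₜ[R] 1 := rfl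

@[simp] theorem incl₁₃_tmul (a b : A) : incl₁₃ R A (a ⊗ₜ[R] b) = a ⊗ₜ[R] 1 ⊗ₜ[R] b := rfl

@[simp] theorem incl₂₃_tmul (a b : A) : incl₂₃ R A (a ⊗ₜ[R] b) = 1 ⊗ₜ[R] a ⊗ₜ[R] b := rfl

@[simp] theorem rotAlg_tmul (a b c : A) :
    rotAlg R A (a ⊗ₜ[R] b ⊗ₜ[R] c) = c ⊗ₜ[R] a ⊗ₜ[R] b := rfl

@[simp] theorem mulFirstThird_tmul (f : A ⊗[R] A) (c : A) :
    mulFirstThird R A (f ⊗ₜ[R] c) = f * (c ⊗ₜ[R] 1) := rfl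

theorem rotAlg_incl₁₂ (f : A ⊗[R] A) : rotAlg R A (incl₁₂ R A f) = incl₂₃ R A f := by
  induction f with
  | zero => simp
  | add f g hf hg => simp [hf, hg]
  | tmul a b => simp

theorem rotAlg_incl₂₃ (f : A ⊗[R] A) :
    rotAlg R A (incl₂₃ R A f) = incl₁₃ R A (flip R A f) := by
  induction f with
  | zero => simp
  | add f g hf hg => simp [hf, hg]
  | tmul a b => simp

theorem rotAlg_incl₁₃ (f : A ⊗[R] A) :
    rotAlg R A (incl₁₃ R A f) = incl₁₂ R A (flip R A f) := by
  induction f with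
  | zero => simp
  | add f g hf hg => simp [hf, hg]
  | tmul a b => simp

theorem mulFirstThird_incl₁₂ (f : A ⊗[R] A) : mulFirstThird R A (incl₁₂ R A f) = f := by
  induction f with
  | zero => simp
  | add f g hf hg => simp [hf, hg]
  | tmul a b => simp

theorem mulFirstThird_incl₂₃ (f : A ⊗[R] A) :
    mulFirstThird R A (incl₂₃ R A f) = flip R A f := by
  induction f with
  | zero => simp
  | add f g hf hg => simp [hf, hg]
  | tmul a b => simp

theorem mulFirstThird_incl₁₃ (f : A ⊗[R] A) :
    mulFirstThird R A (incl₁₃ R A f) = Algebra.TensorProduct.lmul' R f ⊗ₜ[R] 1 := by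
  induction f with
  | zero => simp
  | add f g hf hg => simp [hf, hg, TensorProduct.add_tmul]
  | tmul a b => simp

/-- Being linear in `f`, this applies to `f = φ (b ⊗ c)` without expanding it into pure tensors. -/
theorem rTensor_assoc_symm_tmul {q : A ⊗[R] A}
    (hφ : ∀ a b, φ (a ⊗ₜ[R] b) = diff R a * diff R b * q) (a : A) (f : A ⊗[R] A) :
    φ.rTensor A ((TensorProduct.assoc R A A A).symm (a ⊗ₜ[R] f)) =
      incl₁₂ R A (diff R a * q) * (incl₁₃ R A f - incl₂₃ R A f) := by
  induction f with
  | zero => simp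
  | add f g hf hg => simp only [TensorProduct.tmul_add, map_add, hf, hg]; ring
  | tmul b c =>
    have h : incl₁₃ R A (b ⊗ₜ[R] c) - incl₂₃ R A (b ⊗ₜ[R] c) = diff R b ⊗ₜ[R] c := by
      simp [diff, TensorProduct.sub_tmul]
    rw [h, TensorProduct.assoc_symm_tmul, LinearMap.rTensor_tmul, hφ]
    change _ = (diff R a * q) ⊗ₜ[R] (1 : A) * diff R b ⊗ₜ[R] c
    rw [Algebra.TensorProduct.tmul_mul_tmul, one_mul]
    congr 1
    ring

theorem jacTerm_tmul {q : A ⊗[R] A}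
    (hφ : ∀ a b, φ (a ⊗ₜ[R] b) = diff R a * diff R b * q) (a b c : A) :
    jacTerm φ (a ⊗ₜ[R] b ⊗ₜ[R] c) = incl₁₂ R A (diff R a * q) *
      (incl₁₃ R A (diff R b * diff R c * q) - incl₂₃ R A (diff R b * diff R c * q)) := by
  rw [← rTensor_assoc_symm_tmul hφ, ← hφ]
  rfl

/-- Rotation fixes `t ⊗ t ⊗ t`, so conjugating only rotates the output. -/
theorem jacobiator_tmul_self (φ : A ⊗[R] A →ₗ[R] A ⊗[R] A) (t : A) :
    jacobiator φ (t ⊗ₜ[R] t ⊗ₜ[R] t) = jacTerm φ (t ⊗ₜ[R] t ⊗ₜ[R] t) +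
      rotAlg R A (jacTerm φ (t ⊗ₜ[R] t ⊗ₜ[R] t)) +
      rotAlg R A (rotAlg R A (jacTerm φ (t ⊗ₜ[R] t ⊗ₜ[R] t))) :=
  rfl

theorem jacobiator_tmul_self_eq {q : A ⊗[R] A} (hq : flip R A q = -q)
    (hφ : ∀ a b, φ (a ⊗ₜ[R] b) = diff R a * diff R b * q) (t : A) :
    jacobiator φ (t ⊗ₜ[R] t ⊗ₜ[R] t) =
      incl₁₂ R A (diff R t) * (incl₂₃ R A (diff R t) * (incl₁₃ R A (diff R t) *
        (incl₂₃ R A q * incl₁₃ R A q + incl₁₃ R A q * incl₁₂ R A q -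
          incl₁₂ R A q * incl₂₃ R A q))) := by
  have h : incl₁₃ R A (diff R t) = incl₁₂ R A (diff R t) + incl₂₃ R A (diff R t) := by
    simp [diff]
  rw [jacobiator_tmul_self, jacTerm_tmul hφ]
  simp only [map_mul, map_sub, map_neg, rotAlg_incl₁₂, rotAlg_incl₁₃, rotAlg_incl₂₃, flip_diff,
    hq]
  -- With `u = diff₁₂`, `v = diff₂₃` and `u + v = diff₁₃`, each product of two copies of `q`
  -- acquires the coefficient `±uv(u + v)`.
  rw [h]
  ring

/-- The quadratic relation extracted from the double Jacobi relation has no nonzero antisymmetric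
solution over a reduced ring. -/
theorem eq_zero_of_incl_relation [IsReduced A] [IsReduced (A ⊗[R] A)] {q : A ⊗[R] A}
    (hq : flip R A q = -q)
    (h : incl₂₃ R A q * incl₁₃ R A q + incl₁₃ R A q * incl₁₂ R A q -
      incl₁₂ R A q * incl₂₃ R A q = 0) : q = 0 := by
  -- The images of `q₁₂`, `q₂₃`, `q₁₃` are `q`, `-q`, `m ⊗ 1`, where `m` is the product of the two
  -- factors of `q`.
  have h1 := congrArg (mulFirstThird R A) h
  simp only [map_add, map_sub, map_mul, map_zero, mulFirstThird_incl₁₂, mulFirstThird_incl₁₃,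
    mulFirstThird_incl₂₃, hq] at h1
  have h2 := congrArg (Algebra.TensorProduct.lmul' R) h1
  simp only [map_add, map_sub, map_mul, map_neg, map_zero,
    Algebra.TensorProduct.lmul'_apply_tmul, mul_one] at h2
  have h3 : Algebra.TensorProduct.lmul' R q = 0 := by
    apply pow_eq_zero_iff two_ne_zero |>.mp
    linear_combination h2
  rw [h3, TensorProduct.zero_tmul] at h1
  apply pow_eq_zero_iff two_ne_zero |>.mp
  linear_combination h1

/-- A commutative algebra with sufficiently regular universal differences has no nonzero double
Poisson structure. -/
theorem IsDoublePoisson.eq_zero_of_isLeftRegular [IsReduced A] [IsReduced (A ⊗[R] A)]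
    (h : IsDoublePoisson φ) {s t : A} (hs : IsLeftRegular (diff R s))
    (ht : IsLeftRegular (diff R t)) (hst : ∀ f, diff R s ∣ diff R t * f → diff R s ∣ f)
    (h₁₂ : IsLeftRegular (incl₁₂ R A (diff R s))) (h₂₃ : IsLeftRegular (incl₂₃ R A (diff R s)))
    (h₁₃ : IsLeftRegular (incl₁₃ R A (diff R s))) : φ = 0 := by
  obtain ⟨q, hq, hφ⟩ := h.1.exists_eq_diff_mul hs ht hst
  have hJ := jacobiator_tmul_self_eq hq hφ s
  rw [h.2, LinearMap.zero_apply, eq_comm, h₁₂.mul_left_eq_zero_iff, h₂₃.mul_left_eq_zero_iff,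
    h₁₃.mul_left_eq_zero_iff] at hJ
  refine TensorProduct.ext' fun a b => ?_
  rw [hφ, eq_zero_of_incl_relation hq hJ, mul_zero, LinearMap.zero_apply]

end Jacobi

end Commutative

/-! ### Regularity for polynomial rings -/

section MvPolynomial

variable {R σ : Type*} [CommRing R]

theorem isLeftRegular_incl₁₃_diff_X (i : σ) :
    IsLeftRegular (incl₁₃ R _ (diff R (MvPolynomial.X i : MvPolynomial σ R))) := by
  simpa [diff, Algebra.TensorProduct.one_def] using
    MvPolynomial.isLeftRegular_tmul_sub_tmul_X (R := R)
      (fun i : σ => (MvPolynomial.X i : MvPolynomial σ R) ⊗ₜ[R] (1 : MvPolynomial σ R)) i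

theorem isLeftRegular_incl₂₃_diff_X (i : σ) :
    IsLeftRegular (incl₂₃ R _ (diff R (MvPolynomial.X i : MvPolynomial σ R))) := by
  simpa [diff, Algebra.TensorProduct.one_def] using
    MvPolynomial.isLeftRegular_tmul_sub_tmul_X (R := R)
      (fun i : σ => (1 : MvPolynomial σ R) ⊗ₜ[R] (MvPolynomial.X i : MvPolynomial σ R)) i

theorem isLeftRegular_incl₁₂_diff_X (i : σ) :
    IsLeftRegular (incl₁₂ R _ (diff R (MvPolynomial.X i : MvPolynomial σ R))) := by
  intro f g h
  apply (rotAlg R _).injective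
  apply isLeftRegular_incl₂₃_diff_X i
  simpa [rotAlg_incl₁₂] using congrArg (rotAlg R _) h

/-- A polynomial ring in at least two variables over a reduced ring has no nonzero double Poisson
structure. -/
theorem IsDoublePoisson.eq_zero [IsReduced R] [Nontrivial σ]
    {φ : MvPolynomial σ R ⊗[R] MvPolynomial σ R →ₗ[R] MvPolynomial σ R ⊗[R] MvPolynomial σ R}
    (hφ : IsDoublePoisson φ) : φ = 0 := by
  obtain ⟨i, j, hij⟩ := exists_pair_ne σ
  have : IsReduced (MvPolynomial σ R ⊗[R] MvPolynomial σ R) :=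
    MvPolynomial.isReduced_tensorProduct
  exact hφ.eq_zero_of_isLeftRegular
    (MvPolynomial.isLeftRegular_tmul_sub_tmul_X (R := R) MvPolynomial.X i)
    (MvPolynomial.isLeftRegular_tmul_sub_tmul_X (R := R) MvPolynomial.X j)
    (fun _ => MvPolynomial.tmul_sub_tmul_X_dvd MvPolynomial.X hij)
    (isLeftRegular_incl₁₂_diff_X i) (isLeftRegular_incl₂₃_diff_X i)
    (isLeftRegular_incl₁₃_diff_X i)

end MvPolynomial

end DoublePoisson

theorem theorem5p7 {R : Type*} [CommRing R] (hR : ∀ x : R, x ^ 2 = 0 → x = 0)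
    (d : ℕ) (hd : 2 ≤ d)
    (φ : MvPolynomial (Fin d) R ⊗[R] MvPolynomial (Fin d) R →ₗ[R]
      MvPolynomial (Fin d) R ⊗[R] MvPolynomial (Fin d) R)
    (hφ : DoublePoisson.IsDoublePoisson φ) : φ = 0 := by
  have : IsReduced R := (isReduced_iff_pow_one_lt 2 one_lt_two).mpr hR
  have : Nontrivial (Fin d) := Fin.nontrivial_iff_two_le.mpr hd
  exact hφ.eq_zero
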